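/- Let $R$ be an associative ring with identity that is left hereditary (every left ideal is a projective left $R$-module) and not semisimple, and let $T(R)=\begin{pmatrix}R&0\\R&R\end{pmatrix}$ be the ring of lower triangular $2\times 2$ matrices over $R$. For a left $T(R)$-module $M$ put $M_1=e_{11}M$ and $M_2=e_{22}M$ ($R$-modules via $r\mapsto\mathrm{diag}(r,r)$), and let $\varphi^M:M_1\to M_2$, $x\mapsto e_{21}x$, be its structure map; thus $M$ is identified with the triple $\begin{pmatrix}M_1\\M_2\end{pmatrix}_{\varphi^M}$. An $n$-th syzygy of $M$ is a module $K$ for which there is an exact sequence $0\to K\to P_{n-1}\to\cdots\to P_0\to M\to 0$ with all $P_i$ projective. Write $\mathrm{pd}$ for projective dimension and $\mathrm{lD}$ for left global dimension. Then: 1. $\mathrm{lD}(R)=1$ and $\mathrm{lD}(T(R))=\mathrm{lD}(R)+1=2$, and there is a left $T(R)$-module $M$ with $\mathrm{pd}_{T(R)}(M)=2$. 2. Every left $T(R)$-module $M$ with $\mathrm{pd}_{T(R)}(M)=2$ satisfies $\mathrm{pd}_R(M_1)\le 1$ and $\mathrm{pd}_R(\mathrm{Coker}\,\varphi^M)\le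 1$; it has a first syzygy, and for every first syzygy $K$ of $M$ the structure map $\varphi^K:K_1\to K_2$ is injective. 3. Consequently the following characterisation (claimed by Asadollahi and Salarian for all $n\ge 0$ and all triangular matrix rings) fails over $T(R)$ for $n=1$: for every left $T(R)$-module $M$ and every $n$-th syzygy $K$ of $M$, one has $\mathrm{pd}_{T(R)}(M)\le n$ if and only if $\mathrm{pd}_R(M_1)\le n$, $\mathrm{pd}_R(\mathrm{Coker}\,\varphi^M)\le n$ and $\varphi^K$ is injective. -/

import Mathlib

universe u

/-- A ring is left hereditary if every left ideal is a projective left module. -/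
def IsLeftHereditary (R : Type u) [Ring R] : Prop :=
  ∀ I : Submodule R R, Module.Projective R I

/-- The left global dimension: the supremum of the projective dimensions of all left modules. -/
noncomputable def leftGlobalDimension (R : Type u) [Ring R] : WithBot ℕ∞ :=
  ⨆ M : ModuleCat.{u} R, CategoryTheory.projectiveDimension M

/-- The ring `T(R)` of lower triangular `2 × 2` matrices over `R`. -/
def T2Ext (R : Type u) [Ring R] : Subring (Matrix (Fin 2) (Fin 2) R) where
  carrier := {X | X 0 1 = 0}
  mul_mem' := by
    intro X Y hX hY
    simp only [Set.mem_ofPred_eq] at hX hY ⊢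
    simp [Matrix.mul_apply, Fin.sum_univ_two, hX, hY]
  one_mem' := by simp
  add_mem' := by
    intro X Y hX hY
    simp only [Set.mem_ofPred_eq] at hX hY ⊢
    simp [hX, hY]
  zero_mem' := by simp
  neg_mem' := by
    intro X hX
    simp only [Set.mem_ofPred_eq] at hX ⊢
    simp [hX]

namespace T2Ext

variable {R : Type u} [Ring R]

/-- The diagonal embedding `r ↦ diag(r, r)` of `R` into `T(R)`. -/
def diag (R : Type u) [Ring R] : R →+* T2Ext R :=
  (Matrix.scalar (Fin 2)).codRestrict (T2Ext R) (fun r => by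
    change (Matrix.scalar (Fin 2) r) 0 1 = 0
    simp)

/-- The matrix unit with entry `1` in the upper left corner. -/
def e₁ (R : Type u) [Ring R] : T2Ext R :=
  ⟨!![1, 0; 0, 0], by change (0 : R) = 0; rfl⟩

/-- The matrix unit with entry `1` in the lower right corner. -/
def e₂ (R : Type u) [Ring R] : T2Ext R :=
  ⟨!![0, 0; 0, 1], by change (0 : R) = 0; rfl⟩

/-- The matrix unit with entry `1` in the lower left corner. -/
def e₂₁ (R : Type u) [Ring R] : T2Ext R :=
  ⟨!![0, 0; 1, 0], by change (0 : R) = 0; rfl⟩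

theorem diag_comm_e₁ (r : R) : e₁ R * diag R r = diag R r * e₁ R := by
  apply Subtype.ext
  change (!![1, 0; 0, 0] : Matrix (Fin 2) (Fin 2) R) * Matrix.scalar (Fin 2) r
    = Matrix.scalar (Fin 2) r * !![1, 0; 0, 0]
  ext i j
  fin_cases i <;> fin_cases j <;> simp [Matrix.mul_apply, Fin.sum_univ_two]

theorem diag_comm_e₂ (r : R) : e₂ R * diag R r = diag R r * e₂ R := by
  apply Subtype.ext
  change (!![0, 0; 0, 1] : Matrix (Fin 2) (Fin 2) R) * Matrix.scalar (Fin 2) r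
    = Matrix.scalar (Fin 2) r * !![0, 0; 0, 1]
  ext i j
  fin_cases i <;> fin_cases j <;> simp [Matrix.mul_apply, Fin.sum_univ_two]

theorem diag_comm_e₂₁ (r : R) : e₂₁ R * diag R r = diag R r * e₂₁ R := by
  apply Subtype.ext
  change (!![0, 0; 1, 0] : Matrix (Fin 2) (Fin 2) R) * Matrix.scalar (Fin 2) r
    = Matrix.scalar (Fin 2) r * !![0, 0; 1, 0]
  ext i j
  fin_cases i <;> fin_cases j <;> simp [Matrix.mul_apply, Fin.sum_univ_two]

theorem e₂_mul_e₂₁ : e₂ R * e₂₁ R = e₂₁ R := by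
  apply Subtype.ext
  change (!![0, 0; 0, 1] : Matrix (Fin 2) (Fin 2) R) * !![0, 0; 1, 0] = !![0, 0; 1, 0]
  ext i j
  fin_cases i <;> fin_cases j <;> simp [Matrix.mul_apply, Fin.sum_univ_two]

/-- A `T(R)`-module regarded as an `R`-module through `r ↦ diag(r, r)`. -/
noncomputable abbrev res (M : ModuleCat.{u} (T2Ext R)) : ModuleCat.{u} R :=
  (ModuleCat.restrictScalars (diag R)).obj M

/-- Left multiplication by an element of `T(R)` that commutes with all `diag(r, r)`,
as an `R`-linear map. -/
noncomputable def act (M : ModuleCat.{u} (T2Ext R)) (t : T2Ext R)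
    (ht : ∀ r : R, t * diag R r = diag R r * t) : res M →ₗ[R] res M where
  toFun := fun (x : M) => (t • x : M)
  map_add' := fun (x y : M) => smul_add t x y
  map_smul' := fun r (x : M) => by
    change (t • (diag R r • x) : M) = diag R r • (t • x)
    rw [smul_smul, smul_smul, ht]

/-- The first component `M₁ = e₁ M` of a `T(R)`-module `M`. On it `diag(r, r)` and
`diag(r, 0)` act in the same way. -/
noncomputable def comp₁ (M : ModuleCat.{u} (T2Ext R)) : Submodule R (res M) :=
  LinearMap.range (act M (e₁ R) diag_comm_e₁)

/-- The second component `M₂ = e₂ M` of a `T(R)`-module `M`. -/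
noncomputable def comp₂ (M : ModuleCat.{u} (T2Ext R)) : Submodule R (res M) :=
  LinearMap.range (act M (e₂ R) diag_comm_e₂)

/-- The structure map `φ : M₁ → M₂` of a `T(R)`-module `M`: multiplication by the lower left
matrix unit. -/
noncomputable def structureMap (M : ModuleCat.{u} (T2Ext R)) : comp₁ M →ₗ[R] comp₂ M :=
  ((act M (e₂₁ R) diag_comm_e₂₁).comp (comp₁ M).subtype).codRestrict (comp₂ M) (fun x => by
    refine ⟨act M (e₂₁ R) diag_comm_e₂₁ x.1, ?_⟩
    change (e₂ R • (e₂₁ R • (show M from x.1)) : M) = e₂₁ R • (show M from x.1)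
    rw [smul_smul, e₂_mul_e₂₁])

/-- The first component as an object of the category of `R`-modules. -/
noncomputable def fst (M : ModuleCat.{u} (T2Ext R)) : ModuleCat.{u} R :=
  ModuleCat.of R (comp₁ M)

/-- The cokernel `M₂ / φ(M₁)` of the structure map. -/
noncomputable def coker (M : ModuleCat.{u} (T2Ext R)) : ModuleCat.{u} R :=
  ModuleCat.of R (comp₂ M ⧸ LinearMap.range (structureMap M))

end T2Ext

/-- `IsSyzygy n K M`: the module `K` is an `n`-th syzygy of `M`, i.e. there is an exact sequence
`0 → K → P_{n-1} → ⋯ → P₀ → M → 0` with all `P_i` projective. -/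
def IsSyzygy {S : Type u} [Ring S] : ℕ → ModuleCat.{u} S → ModuleCat.{u} S → Prop
  | 0, K, M => Nonempty (CategoryTheory.Iso K M)
  | n + 1, K, M => ∃ (L P : ModuleCat.{u} S) (f : Quiver.Hom K P) (g : Quiver.Hom P L)
      (w : CategoryTheory.CategoryStruct.comp f g = 0),
      IsSyzygy n L M ∧ CategoryTheory.Projective P ∧
        (CategoryTheory.ShortComplex.mk f g w).ShortExact

/-- The Asadollahi–Salarian characterisation of `pd(M) ≤ n` for modules `M` over `T(R)`:
`pd(M) ≤ n` if and only if `pd(M₁) ≤ n`, `pd(Coker φ) ≤ n` and the structure map of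
the `n`-th syzygy of `M` is injective. -/
def ASCharacterisation (R : Type u) [Ring R] (n : ℕ) : Prop :=
  ∀ M K : ModuleCat.{u} (T2Ext R), IsSyzygy n K M →
    (CategoryTheory.projectiveDimension M ≤ n ↔
      CategoryTheory.projectiveDimension (T2Ext.fst M) ≤ n ∧
      CategoryTheory.projectiveDimension (T2Ext.coker M) ≤ n ∧
      Function.Injective (T2Ext.structureMap K))

/-! For `n = 1` the right-hand side of the characterisation always holds. All `R`-modules have
projective dimension at most 1, and a first syzygy sits inside a projective `T(R)`-module, whose
structure map is injective. So the characterisation would give every `T(R)`-module projective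
dimension at most 1.

A counterexample is `X = R ⧸ I`, not projective, placed in the first component. For a first syzygy
`K` inside a projective `P` one has `K₂ = P₂`, hence `X ≅ P₁/K₁` embeds in `P₂/φ(K₁) = Coker φ^K`.
If `K` were projective, so would be this cokernel, and then `X`, because `R` is hereditary
(`projective_of_projective_syzygy`).

The bound 2 rests on the criterion `projective_of_structureMap_injective`. The first syzygy has
injective structure map, so by the snake lemma the cokernel of the second embeds in a projective
`R`-module, and `projective_of_exact` applies. -/

open CategoryTheory

/-! ### Hereditary and semisimple rings. -/

section Hereditary

variable {R : Type u} [Ring R]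

/-- Over a left hereditary ring, quotients of injective modules are injective. -/
theorem IsLeftHereditary.injective_of_surjective (hR : IsLeftHereditary R)
    {E N : Type u} [AddCommGroup E] [Module R E] [AddCommGroup N] [Module R N]
    [Module.Injective R E] (f : E →ₗ[R] N) (hf : Function.Surjective f) :
    Module.Injective R N := by
  refine Module.Baer.injective fun I g => ?_
  have : Module.Projective R I := hR I
  -- Baer's criterion: lift from the projective ideal to `E`, extend to `R` there, and push back to
  -- `N`.
  obtain ⟨h, hh⟩ := Module.projective_lifting_property f g hf
  obtain ⟨k, hk⟩ := Module.Baer.of_injective (R := R) (Q := E) inferInstance I h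
  exact ⟨f.comp k, fun x hx => by simp [hk x hx, ← hh]⟩

/-- Over a left hereditary ring, a module that embeds into a projective one is projective. -/
theorem IsLeftHereditary.projective_of_injective (hR : IsLeftHereditary R)
    {K P : Type u} [AddCommGroup K] [Module R K] [AddCommGroup P] [Module R P]
    [Module.Projective R P] (i : K →ₗ[R] P) (hi : Function.Injective i) :
    Module.Projective R K := by
  refine Module.Projective.of_lifting_property fun {A B} _ _ _ _ f g hf => ?_
  -- Cartan–Eilenberg: with `A` inside an injective `J`, `B ≅ A / ker f` embeds in `J / ker f`,
  -- again injective. So `g` extends to `P`, and the extension lifts to `J`.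
  obtain ⟨J⟩ := EnoughInjectives.presentation (ModuleCat.of R A)
  have : Injective (ModuleCat.of R J.J) := J.injective
  have hJ : Module.Injective R J.J := Module.injective_module_of_injective_object R J.J
  let j : A →ₗ[R] J.J := J.f.hom
  have hj : Function.Injective j := (ModuleCat.mono_iff_injective J.f).1 J.mono
  let N : Submodule R J.J := (LinearMap.ker f).map j
  have hE := hR.injective_of_surjective N.mkQ N.mkQ_surjective
  let b : B →ₗ[R] J.J ⧸ N :=
    ((LinearMap.ker f).liftQ (N.mkQ.comp j) (fun a ha => by
      simpa [N] using ⟨a, ha, rfl⟩)).comp (f.quotKerEquivOfSurjective hf).symm.toLinearMap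
  have hb : ∀ a, b (f a) = N.mkQ (j a) := fun a => by
    have : (f.quotKerEquivOfSurjective hf).symm (f a) = (LinearMap.ker f).mkQ a := by
      rw [LinearEquiv.symm_apply_eq]; rfl
    simp only [b, LinearMap.comp_apply, LinearEquiv.coe_coe, this]
    rfl
  obtain ⟨h, hh⟩ := hE.out i hi (b.comp g)
  obtain ⟨l, hl⟩ := Module.projective_lifting_property N.mkQ h N.mkQ_surjective
  -- On `K` the lift takes values in `A`: modulo `j (ker f)` it agrees with a preimage of `g x`,
  -- which can be corrected by an element of `ker f`.
  have key : ∀ x, ∃ a, j a = l (i x) ∧ f a = g x := fun x => by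
    obtain ⟨a, ha⟩ := hf (g x)
    have h1 : N.mkQ (l (i x)) = N.mkQ (j a) := by
      rw [← LinearMap.comp_apply, hl, hh, LinearMap.comp_apply, ← ha, hb]
    obtain ⟨c, hc, hc'⟩ := (Submodule.Quotient.eq N).1 h1
    refine ⟨c + a, by rw [map_add, hc']; simp, ?_⟩
    rw [map_add, LinearMap.mem_ker.1 hc, zero_add, ha]
  let e := LinearEquiv.ofInjective j hj
  let k : K →ₗ[R] A := e.symm.toLinearMap.comp ((l.comp i).codRestrict (LinearMap.range j)
    fun x => (key x).imp fun a ha => ha.1)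
  refine ⟨k, LinearMap.ext fun x => ?_⟩
  obtain ⟨a, ha, ha'⟩ := key x
  have : k x = a := by
    simp only [k, LinearMap.comp_apply, LinearEquiv.coe_coe, LinearEquiv.symm_apply_eq]
    exact Subtype.ext ha.symm
  rw [LinearMap.comp_apply, this, ha']

/-- A short exact sequence with projective middle term computes `pd ≤ 1`. -/
theorem CategoryTheory.ShortComplex.ShortExact.projectiveDimension_le_one_iff
    {S : ShortComplex (ModuleCat.{u} R)} (hS : S.ShortExact) (h₂ : Projective S.X₂) :
    projectiveDimension S.X₃ ≤ 1 ↔ Module.Projective R S.X₁ := by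
  have h := projectiveDimension_le_iff S.X₃ 1
  rw [Nat.cast_one] at h
  rw [h]
  refine (hS.hasProjectiveDimensionLT_X₃_iff 0 h₂).trans ?_
  rw [zero_add, ← projective_iff_hasProjectiveDimensionLT_one]
  exact ⟨fun _ => inferInstance, fun _ => inferInstance⟩

theorem IsLeftHereditary.projectiveDimension_le_one (hR : IsLeftHereditary R)
    (M : ModuleCat.{u} R) : projectiveDimension M ≤ 1 := by
  have hS := M.shortExact_projectiveShortComplex
  have h₂ : Projective M.projectiveShortComplex.X₂ := inferInstance
  have : Module.Projective R M.projectiveShortComplex.X₂ := inferInstance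
  exact (hS.projectiveDimension_le_one_iff h₂).2
    (hR.projective_of_injective M.projectiveShortComplex.f.hom hS.moduleCat_injective_f)

/-- A ring all of whose cyclic modules are projective is semisimple. -/
theorem exists_not_projective_of_not_isSemisimpleRing (hss : ¬ IsSemisimpleRing R) :
    ∃ I : Submodule R R, ¬ Module.Projective R (R ⧸ I) := by
  contrapose! hss
  refine (isSemisimpleModule_iff R R).2 ⟨fun I => ?_⟩
  have := hss I
  -- A section of `R → R ⧸ I` has as its range a complement of `I`.
  obtain ⟨s, hs⟩ := Module.projective_lifting_property I.mkQ LinearMap.id I.mkQ_surjective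
  have hs' : ∀ x, I.mkQ (s x) = x := fun x => LinearMap.congr_fun hs x
  refine ⟨LinearMap.range s, Submodule.disjoint_def.2 ?_, codisjoint_iff.2 ?_⟩
  · rintro _ hx ⟨y, rfl⟩
    rw [← hs' y, Submodule.mkQ_apply, (Submodule.Quotient.mk_eq_zero I).2 hx, map_zero]
  · refine Submodule.eq_top_iff'.2 fun x => Submodule.mem_sup.2
      ⟨x - s (I.mkQ x), ?_, s (I.mkQ x), ⟨_, rfl⟩, by abel⟩
    rw [← Submodule.Quotient.mk_eq_zero, ← Submodule.mkQ_apply, map_sub, hs', sub_self]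

end Hereditary

/-! ### Matrix units, components and induced maps. -/

namespace T2Ext

variable {R : Type u} [Ring R]

theorem e₁_mul_e₁ : e₁ R * e₁ R = e₁ R := by
  ext i j; fin_cases i <;> fin_cases j <;> simp [e₁]

theorem e₂_mul_e₂ : e₂ R * e₂ R = e₂ R := by
  ext i j; fin_cases i <;> fin_cases j <;> simp [e₂]

theorem e₁_mul_e₂ : e₁ R * e₂ R = 0 := by
  ext i j; fin_cases i <;> fin_cases j <;> simp [e₁, e₂]

theorem e₂_mul_e₁ : e₂ R * e₁ R = 0 := by
  ext i j; fin_cases i <;> fin_cases j <;> simp [e₁, e₂]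

theorem e₁_mul_e₂₁ : e₁ R * e₂₁ R = 0 := by
  ext i j; fin_cases i <;> fin_cases j <;> simp [e₁, e₂₁]

theorem e₂₁_mul_e₁ : e₂₁ R * e₁ R = e₂₁ R := by
  ext i j; fin_cases i <;> fin_cases j <;> simp [e₁, e₂₁]

theorem e₂₁_mul_e₂ : e₂₁ R * e₂ R = 0 := by
  ext i j; fin_cases i <;> fin_cases j <;> simp [e₂, e₂₁]

theorem e₂₁_mul_e₂₁ : e₂₁ R * e₂₁ R = 0 := by
  ext i j; fin_cases i <;> fin_cases j <;> simp [e₂₁]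

theorem e₁_add_e₂ : e₁ R + e₂ R = 1 := by
  ext i j; fin_cases i <;> fin_cases j <;> simp [e₁, e₂]

theorem apply_zero_one (t : T2Ext R) : t.1 0 1 = 0 := t.2

/-- Reduces `T(R)`-linearity to `R`-linearity and compatibility with three matrix units. -/
theorem eq_diag_mul (t : T2Ext R) :
    t = diag R (t.1 0 0) * e₁ R + diag R (t.1 1 0) * e₂₁ R + diag R (t.1 1 1) * e₂ R := by
  ext i j
  have := apply_zero_one t
  fin_cases i <;> fin_cases j <;> simp [e₁, e₂, e₂₁, diag, Matrix.mul_apply, this]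

theorem e₁_mul (t : T2Ext R) : e₁ R * t = diag R (t.1 0 0) * e₁ R := by
  ext i j
  have := apply_zero_one t
  fin_cases i <;> fin_cases j <;> simp [e₁, diag, Matrix.mul_apply, this]

theorem e₂_mul (t : T2Ext R) :
    e₂ R * t = e₂₁ R * diag R (t.1 1 0) + diag R (t.1 1 1) * e₂ R := by
  ext i j
  have := apply_zero_one t
  fin_cases i <;> fin_cases j <;> simp [e₂, e₂₁, diag, Matrix.mul_apply, this]

/-- The upper left entry, as a ring homomorphism `T(R) → R`. -/
def entry₁ (R : Type u) [Ring R] : T2Ext R →+* R where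
  toFun t := t.1 0 0
  map_one' := by simp
  map_zero' := by simp
  map_add' := by simp
  map_mul' s t := by simp [Matrix.mul_apply, apply_zero_one s]

/-- The lower right entry, as a ring homomorphism `T(R) → R`. -/
def entry₂ (R : Type u) [Ring R] : T2Ext R →+* R where
  toFun t := t.1 1 1
  map_one' := by simp
  map_zero' := by simp
  map_add' := by simp
  map_mul' s t := by simp [Matrix.mul_apply, apply_zero_one t]

theorem entry₁_diag (r : R) : entry₁ R (diag R r) = r := by
  change Matrix.scalar (Fin 2) r 0 0 = r
  simp

theorem entry₂_diag (r : R) : entry₂ R (diag R r) = r := by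
  change Matrix.scalar (Fin 2) r 1 1 = r
  simp

theorem entry₂_e₂₁ : entry₂ R (e₂₁ R) = 0 := rfl

theorem entry₁_e₁ : entry₁ R (e₁ R) = 1 := rfl

theorem entry₁_e₂ : entry₁ R (e₂ R) = 0 := rfl

variable (M : ModuleCat.{u} (T2Ext R))

/-- The projection `x ↦ e₁ x` of a `T(R)`-module onto its first component. -/
noncomputable def proj₁ : res M →ₗ[R] comp₁ M := (act M (e₁ R) diag_comm_e₁).rangeRestrict

/-- The projection `x ↦ e₂ x` of a `T(R)`-module onto its second component. -/
noncomputable def proj₂ : res M →ₗ[R] comp₂ M := (act M (e₂ R) diag_comm_e₂).rangeRestrict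

variable {M}

/-- Scalar multiplication by `T(R)` on `res M`. -/
theorem act_act {s t : T2Ext R} (hs ht) (x : res M) :
    act M s hs (act M t ht x) = act M (s * t) (fun r => by
      rw [mul_assoc, ht, ← mul_assoc, hs, mul_assoc]) x :=
  smul_smul s t (show M from x)

theorem act_zero (h) (x : res M) : act M 0 h x = 0 := zero_smul (T2Ext R) (show M from x)

theorem act_congr {s t : T2Ext R} (hst : s = t) (hs ht) (x : res M) :
    act M s hs x = act M t ht x := by subst hst; rfl

theorem coe_structureMap (x : comp₁ M) :
    (structureMap M x : res M) = act M (e₂₁ R) diag_comm_e₂₁ x := rfl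

theorem act_e₁_coe (x : comp₁ M) : act M (e₁ R) diag_comm_e₁ x = x := by
  obtain ⟨_, y, rfl⟩ := x
  exact (act_act _ _ y).trans (act_congr e₁_mul_e₁ _ _ y)

theorem act_e₂_coe (x : comp₂ M) : act M (e₂ R) diag_comm_e₂ x = x := by
  obtain ⟨_, y, rfl⟩ := x
  exact (act_act _ _ y).trans (act_congr e₂_mul_e₂ _ _ y)

theorem proj₁_coe (x : comp₁ M) : proj₁ M x = x := Subtype.ext (act_e₁_coe x)

theorem proj₂_coe (x : comp₂ M) : proj₂ M x = x := Subtype.ext (act_e₂_coe x)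

theorem proj₁_act_e₁ (x : res M) : proj₁ M (act M (e₁ R) diag_comm_e₁ x) = proj₁ M x :=
  proj₁_coe (proj₁ M x)

theorem proj₂_act_e₂ (x : res M) : proj₂ M (act M (e₂ R) diag_comm_e₂ x) = proj₂ M x :=
  proj₂_coe (proj₂ M x)

theorem proj₂_act_e₁ (x : res M) : proj₂ M (act M (e₁ R) diag_comm_e₁ x) = 0 :=
  Subtype.ext ((act_act _ _ x).trans ((act_congr e₂_mul_e₁ _ (by simp) x).trans (act_zero _ x)))

theorem proj₁_act_e₂ (x : res M) : proj₁ M (act M (e₂ R) diag_comm_e₂ x) = 0 :=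
  Subtype.ext ((act_act _ _ x).trans ((act_congr e₁_mul_e₂ _ (by simp) x).trans (act_zero _ x)))

theorem proj₁_act_e₂₁ (x : res M) : proj₁ M (act M (e₂₁ R) diag_comm_e₂₁ x) = 0 :=
  Subtype.ext ((act_act _ _ x).trans ((act_congr e₁_mul_e₂₁ _ (by simp) x).trans (act_zero _ x)))

theorem act_e₂₁_act_e₁ (x : res M) :
    act M (e₂₁ R) diag_comm_e₂₁ (act M (e₁ R) diag_comm_e₁ x) = act M (e₂₁ R) diag_comm_e₂₁ x :=
  (act_act _ _ x).trans (act_congr e₂₁_mul_e₁ _ _ x)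

theorem act_e₂₁_act_e₂ (x : res M) :
    act M (e₂₁ R) diag_comm_e₂₁ (act M (e₂ R) diag_comm_e₂ x) = 0 :=
  (act_act _ _ x).trans ((act_congr e₂₁_mul_e₂ _ (by simp) x).trans (act_zero _ x))

theorem act_e₂₁_act_e₂₁ (x : res M) :
    act M (e₂₁ R) diag_comm_e₂₁ (act M (e₂₁ R) diag_comm_e₂₁ x) = 0 :=
  (act_act _ _ x).trans ((act_congr e₂₁_mul_e₂₁ _ (by simp) x).trans (act_zero _ x))

theorem act_e₂_act_e₂₁ (x : res M) :
    act M (e₂ R) diag_comm_e₂ (act M (e₂₁ R) diag_comm_e₂₁ x) = act M (e₂₁ R) diag_comm_e₂₁ x :=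
  (act_act _ _ x).trans (act_congr e₂_mul_e₂₁ _ _ x)

theorem act_e₁_act_e₁ (x : res M) :
    act M (e₁ R) diag_comm_e₁ (act M (e₁ R) diag_comm_e₁ x) = act M (e₁ R) diag_comm_e₁ x :=
  (act_act _ _ x).trans (act_congr e₁_mul_e₁ _ _ x)

theorem act_e₁_act_e₂₁ (x : res M) :
    act M (e₁ R) diag_comm_e₁ (act M (e₂₁ R) diag_comm_e₂₁ x) = 0 :=
  (act_act _ _ x).trans ((act_congr e₁_mul_e₂₁ _ (by simp) x).trans (act_zero _ x))

theorem act_e₁_act_e₂ (x : res M) :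
    act M (e₁ R) diag_comm_e₁ (act M (e₂ R) diag_comm_e₂ x) = 0 :=
  (act_act _ _ x).trans ((act_congr e₁_mul_e₂ _ (by simp) x).trans (act_zero _ x))

theorem act_e₂_act_e₁ (x : res M) :
    act M (e₂ R) diag_comm_e₂ (act M (e₁ R) diag_comm_e₁ x) = 0 :=
  (act_act _ _ x).trans ((act_congr e₂_mul_e₁ _ (by simp) x).trans (act_zero _ x))

theorem act_e₂_act_e₂ (x : res M) :
    act M (e₂ R) diag_comm_e₂ (act M (e₂ R) diag_comm_e₂ x) = act M (e₂ R) diag_comm_e₂ x :=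
  (act_act _ _ x).trans (act_congr e₂_mul_e₂ _ _ x)

theorem structureMap_proj₁ (x : res M) :
    structureMap M (proj₁ M x) = proj₂ M (act M (e₂₁ R) diag_comm_e₂₁ x) :=
  Subtype.ext ((act_e₂₁_act_e₁ x).trans (act_e₂_act_e₂₁ x).symm)

theorem proj₁_add_proj₂ (x : res M) : (proj₁ M x : res M) + proj₂ M x = x := by
  change (e₁ R • (show M from x) + e₂ R • (show M from x) : M) = x
  rw [← add_smul, e₁_add_e₂, one_smul]

variable {N : ModuleCat.{u} (T2Ext R)}

/-- An `R`-linear map commuting with the matrix units is `T(R)`-linear. -/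
noncomputable def ofCommAct (h : res M →ₗ[R] res N)
    (h₁ : ∀ x, h (act M (e₁ R) diag_comm_e₁ x) = act N (e₁ R) diag_comm_e₁ (h x))
    (h₂ : ∀ x, h (act M (e₂ R) diag_comm_e₂ x) = act N (e₂ R) diag_comm_e₂ (h x))
    (h₂₁ : ∀ x, h (act M (e₂₁ R) diag_comm_e₂₁ x) = act N (e₂₁ R) diag_comm_e₂₁ (h x)) :
    M →ₗ[T2Ext R] N where
  toFun x := h x
  map_add' x y := map_add h x y
  map_smul' t (x : M) := by
    have hd : ∀ (r : R) (y : M), (h (diag R r • y : M) : N) = diag R r • (h y : N) :=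
      fun r y => map_smul h r (show res M from y)
    have ha : ∀ y z : M, (h (y + z : M) : N) = (h y : N) + h z := fun y z => map_add h y z
    have k₁ : ∀ y : M, (h (e₁ R • y : M) : N) = e₁ R • (h y : N) := h₁
    have k₂ : ∀ y : M, (h (e₂ R • y : M) : N) = e₂ R • (h y : N) := h₂
    have k₂₁ : ∀ y : M, (h (e₂₁ R • y : M) : N) = e₂₁ R • (h y : N) := h₂₁
    have hN : ∀ y : N, t • y = diag R (t.1 0 0) • e₁ R • y + diag R (t.1 1 0) • e₂₁ R • y +
        diag R (t.1 1 1) • e₂ R • y := fun y => by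
      conv_lhs => rw [eq_diag_mul t]
      simp only [add_smul, mul_smul]
    refine Eq.trans ?_ (hN (h x)).symm
    conv_lhs => rw [eq_diag_mul t]
    simp only [add_smul, mul_smul, ha, hd, k₁, k₂, k₂₁]
    rfl

/-- Restriction of scalars along the diagonal embedding, on morphisms. -/
noncomputable def resMap (f : M →ₗ[T2Ext R] N) : res M →ₗ[R] res N where
  toFun x := f (show M from x)
  map_add' x y := map_add f x y
  map_smul' r x := map_smul f (diag R r) (show M from x)

theorem resMap_act (f : M →ₗ[T2Ext R] N) (t : T2Ext R) (ht) (x : res M) :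
    resMap f (act M t ht x) = act N t ht (resMap f x) := map_smul f t (show M from x)

/-- The map induced on first components. -/
noncomputable def map₁ (f : M →ₗ[T2Ext R] N) : comp₁ M →ₗ[R] comp₁ N :=
  ((resMap f).comp (comp₁ M).subtype).codRestrict _ fun x =>
    ⟨resMap f x, by rw [← resMap_act, act_e₁_coe]; rfl⟩

/-- The map induced on second components. -/
noncomputable def map₂ (f : M →ₗ[T2Ext R] N) : comp₂ M →ₗ[R] comp₂ N :=
  ((resMap f).comp (comp₂ M).subtype).codRestrict _ fun x =>
    ⟨resMap f x, by rw [← resMap_act, act_e₂_coe]; rfl⟩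

theorem structureMap_map₁ (f : M →ₗ[T2Ext R] N) (x : comp₁ M) :
    structureMap N (map₁ f x) = map₂ f (structureMap M x) :=
  Subtype.ext (resMap_act f (e₂₁ R) diag_comm_e₂₁ x).symm

theorem map₁_proj₁ (f : M →ₗ[T2Ext R] N) (x : res M) :
    map₁ f (proj₁ M x) = proj₁ N (resMap f x) := Subtype.ext (resMap_act f _ _ x)

theorem map₂_proj₂ (f : M →ₗ[T2Ext R] N) (x : res M) :
    map₂ f (proj₂ M x) = proj₂ N (resMap f x) := Subtype.ext (resMap_act f _ _ x)

theorem map₁_injective {f : M →ₗ[T2Ext R] N} (hf : Function.Injective f) :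
    Function.Injective (map₁ f) :=
  fun _ _ h => Subtype.ext (hf (congrArg Subtype.val h))

theorem map₂_injective {f : M →ₗ[T2Ext R] N} (hf : Function.Injective f) :
    Function.Injective (map₂ f) :=
  fun _ _ h => Subtype.ext (hf (congrArg Subtype.val h))

/-- On a submodule the structure map is a restriction. This is what makes the syzygy condition
automatic. -/
theorem structureMap_injective_of_injective {f : M →ₗ[T2Ext R] N} (hf : Function.Injective f)
    (hN : Function.Injective (structureMap N)) : Function.Injective (structureMap M) :=
  fun x y h => map₁_injective hf (hN (by rw [structureMap_map₁, structureMap_map₁, h]))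

/-! ### Exactness of components, and cokernels. -/

section Exact

variable {L : ModuleCat.{u} (T2Ext R)} {f : L →ₗ[T2Ext R] M} {g : M →ₗ[T2Ext R] N}

/-- A preimage `z` of an element fixed by the idempotent `e₁` may be replaced by `e₁ z`. -/
theorem exact_map₁ (h : Function.Exact f g) : Function.Exact (map₁ f) (map₁ g) := by
  intro x
  constructor
  · intro hx
    obtain ⟨z, hz⟩ := (h (show M from x.1)).1 (congrArg Subtype.val hx)
    exact ⟨proj₁ L z, (map₁_proj₁ f z).trans
      ((congrArg (proj₁ M) hz).trans (proj₁_coe x))⟩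
  · rintro ⟨z, rfl⟩
    exact Subtype.ext (h.apply_apply_eq_zero (show L from z.1))

theorem exact_map₂ (h : Function.Exact f g) : Function.Exact (map₂ f) (map₂ g) := by
  intro x
  constructor
  · intro hx
    obtain ⟨z, hz⟩ := (h (show M from x.1)).1 (congrArg Subtype.val hx)
    exact ⟨proj₂ L z, (map₂_proj₂ f z).trans
      ((congrArg (proj₂ M) hz).trans (proj₂_coe x))⟩
  · rintro ⟨z, rfl⟩
    exact Subtype.ext (h.apply_apply_eq_zero (show L from z.1))

/-- The map induced on cokernels of the structure maps. -/
noncomputable def mapCoker (f : M →ₗ[T2Ext R] N) :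
    (comp₂ M ⧸ LinearMap.range (structureMap M)) →ₗ[R]
      comp₂ N ⧸ LinearMap.range (structureMap N) :=
  Submodule.mapQ _ _ (map₂ f) (by
    rintro _ ⟨x, rfl⟩
    exact ⟨map₁ f x, structureMap_map₁ f x⟩)

/-- The snake lemma: the kernel of the map on cokernels is hit by `ker φ^N`, which is zero. -/
theorem mapCoker_injective (hf : Function.Injective f) (h : Function.Exact f g)
    (hN : Function.Injective (structureMap N)) : Function.Injective (mapCoker f) := by
  refine (injective_iff_map_eq_zero _).2 fun y => ?_
  obtain ⟨y, rfl⟩ := Submodule.mkQ_surjective _ y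
  intro hy
  obtain ⟨x, hx⟩ := (Submodule.Quotient.mk_eq_zero _).1 hy
  have : map₁ g x = 0 := hN (by
    rw [structureMap_map₁, hx, (exact_map₂ h).apply_apply_eq_zero, map_zero])
  obtain ⟨z, rfl⟩ := (exact_map₁ h x).1 this
  rw [structureMap_map₁] at hx
  exact (Submodule.Quotient.mk_eq_zero _).2 ⟨z, map₂_injective hf hx⟩

end Exact

end T2Ext

namespace T2Ext

variable {R : Type u} [Ring R]

/-! ### Projective modules over the triangular ring. -/

section Projective

variable (M : ModuleCat.{u} (T2Ext R))

/-- The first component of a projective `T(R)`-module is projective: `M ↦ M₁` is left adjoint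
to restriction of scalars along `entry₁`. -/
theorem projective_comp₁ [Module.Projective (T2Ext R) M] : Module.Projective R (comp₁ M) := by
  refine Module.Projective.of_lifting_property fun {A N} _ _ _ _ f g hf => ?_
  let _ : Module (T2Ext R) A := Module.compHom A (entry₁ R)
  let _ : Module (T2Ext R) N := Module.compHom N (entry₁ R)
  let f' : A →ₗ[T2Ext R] N := { f with map_smul' := fun t x => map_smul f (entry₁ R t) x }
  let G : M →ₗ[T2Ext R] N :=
    { toFun := fun x => g (proj₁ M x)
      map_add' := fun x y => map_add (g ∘ₗ proj₁ M) x y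
      map_smul' := fun t x => by
        change g (proj₁ M (t • x : M)) = entry₁ R t • g (proj₁ M x)
        rw [← map_smul]
        refine congrArg g (Subtype.ext ?_)
        change (e₁ R • t • x : M) = diag R (t.1 0 0) • (e₁ R • x)
        rw [smul_smul, smul_smul, e₁_mul] }
  obtain ⟨h, hh⟩ := Module.projective_lifting_property f' G hf
  have hs : ∀ (t : T2Ext R) (x : M), h (t • x) = entry₁ R t • h x := fun t x => map_smul h t x
  let H : comp₁ M →ₗ[R] A :=
    { toFun := fun x => h (show M from x.1)
      map_add' := fun x y => map_add h (show M from x.1) (show M from y.1)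
      map_smul' := fun r x =>
        (hs (diag R r) (show M from x.1)).trans (by rw [entry₁_diag]; rfl) }
  refine ⟨H, LinearMap.ext fun x => ?_⟩
  exact (LinearMap.congr_fun hh (show M from x.1)).trans (congrArg g (proj₁_coe x))

/-- The cokernel of the structure map of a projective `T(R)`-module is projective: `M ↦ Coker φ`
is left adjoint to restriction of scalars along `entry₂`. -/
theorem projective_coker [Module.Projective (T2Ext R) M] :
    Module.Projective R (comp₂ M ⧸ LinearMap.range (structureMap M)) := by
  refine Module.Projective.of_lifting_property fun {A N} _ _ _ _ f g hf => ?_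
  let _ : Module (T2Ext R) A := Module.compHom A (entry₂ R)
  let _ : Module (T2Ext R) N := Module.compHom N (entry₂ R)
  let f' : A →ₗ[T2Ext R] N := { f with map_smul' := fun t x => map_smul f (entry₂ R t) x }
  let q := (LinearMap.range (structureMap M)).mkQ
  let G : M →ₗ[T2Ext R] N :=
    { toFun := fun x => g (q (proj₂ M x))
      map_add' := fun x y => map_add (g ∘ₗ q ∘ₗ proj₂ M) x y
      map_smul' := fun t x => by
        change g (q (proj₂ M (t • x : M))) = entry₂ R t • g (q (proj₂ M x))
        rw [← map_smul, ← map_smul]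
        -- The lower left entry of `t` contributes only an element of the image of `φ`.
        refine congrArg g ((Submodule.Quotient.eq _).2
          ⟨proj₁ M (diag R (t.1 1 0) • x : M), Subtype.ext ?_⟩)
        change (e₂₁ R • e₁ R • diag R (t.1 1 0) • x : M) =
          e₂ R • t • x - diag R (t.1 1 1) • (e₂ R • x)
        rw [smul_smul, smul_smul, smul_smul, smul_smul, e₂_mul, e₂₁_mul_e₁, add_smul,
          add_sub_cancel_right] }
  obtain ⟨h, hh⟩ := Module.projective_lifting_property f' G hf
  have hs : ∀ (t : T2Ext R) (x : M), h (t • x) = entry₂ R t • h x := fun t x => map_smul h t x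
  let H : comp₂ M →ₗ[R] A :=
    { toFun := fun x => h (show M from x.1)
      map_add' := fun x y => map_add h (show M from x.1) (show M from y.1)
      map_smul' := fun r x =>
        (hs (diag R r) (show M from x.1)).trans (by rw [entry₂_diag]; rfl) }
  refine ⟨Submodule.liftQ _ H ?_, Submodule.linearMap_qext _ (LinearMap.ext fun x => ?_)⟩
  · rintro _ ⟨x, rfl⟩
    exact (hs (e₂₁ R) (show M from x.1)).trans (by rw [entry₂_e₂₁, zero_smul])
  · exact (LinearMap.congr_fun hh (show M from x.1)).trans
      (congrArg (fun y => g (q y)) (proj₂_coe x))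

/-- The structure map of a projective `T(R)`-module is injective. -/
theorem structureMap_injective_of_projective [Module.Projective (T2Ext R) M] :
    Function.Injective (structureMap M) := by
  refine (injective_iff_map_eq_zero _).2 fun x hx => ?_
  -- `s` embeds `M` in a free module, and coordinatewise `e₁ t = t` and `e₂₁ t = 0` force `t = 0`.
  obtain ⟨s, hs⟩ := Module.Projective.out (R := T2Ext R) (P := M)
  let y : M := x.1
  have h₁ : e₁ R • y = y := act_e₁_coe x
  have h₂ : e₂₁ R • y = 0 := congrArg Subtype.val hx
  have key : s y = 0 := by
    ext i : 1
    have h₁' : e₁ R * s y i = s y i := by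
      rw [← smul_eq_mul, ← Finsupp.smul_apply, ← map_smul, h₁]
    have h₂' : e₂₁ R * s y i = 0 := by
      rw [← smul_eq_mul, ← Finsupp.smul_apply, ← map_smul, h₂, map_zero, Finsupp.zero_apply]
    generalize s y i = t at h₁' h₂'
    have h00 : t.1 0 0 = 0 := by
      have := congrArg (fun t : T2Ext R => t.1 1 0) h₂'
      simpa [e₂₁, Matrix.mul_apply] using this
    rw [Finsupp.zero_apply, ← h₁', e₁_mul, h00, map_zero, zero_mul]
  have : y = 0 := by rw [← hs y, key, map_zero]
  exact Subtype.ext this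

/-- A `T(R)`-module with injective structure map, projective first component and projective
cokernel is projective. -/
theorem projective_of_structureMap_injective (hφ : Function.Injective (structureMap M))
    [Module.Projective R (comp₁ M)]
    [Module.Projective R (comp₂ M ⧸ LinearMap.range (structureMap M))] :
    Module.Projective (T2Ext R) M := by
  refine Module.Projective.of_lifting_property fun {A N} _ _ _ _ f g hf => ?_
  let A' := ModuleCat.of (T2Ext R) A
  let N' := ModuleCat.of (T2Ext R) N
  let F : res A' →ₗ[R] res N' := resMap (M := A') (N := N') f
  let G : res M →ₗ[R] res N' := resMap (N := N') g
  have hF : ∀ (t : T2Ext R) (ht) x, F (act A' t ht x) = act N' t ht (F x) :=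
    resMap_act (M := A') (N := N') f
  have hG : ∀ (t : T2Ext R) (ht) x, G (act M t ht x) = act N' t ht (G x) :=
    resMap_act (N := N') g
  let q := (LinearMap.range (structureMap M)).mkQ
  -- The section splits `M₂` as `φ(M₁) ⊕ s(Coker φ)`; `ψ` below is the resulting retraction of `φ`.
  obtain ⟨s, hs⟩ := Module.projective_lifting_property q LinearMap.id (Submodule.mkQ_surjective _)
  replace hs : ∀ c, q (s c) = c := LinearMap.congr_fun hs
  have hqφ : ∀ x, q (structureMap M x) = 0 := fun x =>
    (Submodule.Quotient.mk_eq_zero _).2 ⟨x, rfl⟩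
  let ψ : comp₂ M →ₗ[R] comp₁ M :=
    (LinearEquiv.ofInjective _ hφ).symm.toLinearMap ∘ₗ
      (LinearMap.id - s ∘ₗ q).codRestrict (LinearMap.range (structureMap M)) fun y => by
        rw [← Submodule.Quotient.mk_eq_zero]
        change q (y - s (q y)) = 0
        rw [map_sub, hs, sub_self]
  have hψ : ∀ y, structureMap M (ψ y) = y - s (q y) := fun y =>
    congrArg Subtype.val ((LinearEquiv.ofInjective _ hφ).apply_symm_apply _)
  have hψφ : ∀ x, ψ (structureMap M x) = x := fun x => hφ (by
    rw [hψ, hqφ, map_zero, sub_zero])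
  obtain ⟨k₁, hk₁⟩ := Module.projective_lifting_property F (G ∘ₗ (comp₁ M).subtype) hf
  obtain ⟨k₂, hk₂⟩ := Module.projective_lifting_property F (G ∘ₗ (comp₂ M).subtype ∘ₗ s) hf
  replace hk₁ : ∀ x, F (k₁ x) = G x := LinearMap.congr_fun hk₁
  replace hk₂ : ∀ x, F (k₂ x) = G (s x) := LinearMap.congr_fun hk₂
  -- The lifts `k₁`, `k₂` are only `R`-linear; the matrix units move their values to the right
  -- component. On `φ(M₁)` the value is forced by that on `M₁`, while on the complement `k₂` is
  -- free.
  let H : res M →ₗ[R] res A' :=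
    act A' (e₁ R) diag_comm_e₁ ∘ₗ k₁ ∘ₗ proj₁ M +
    act A' (e₂₁ R) diag_comm_e₂₁ ∘ₗ k₁ ∘ₗ ψ ∘ₗ proj₂ M +
    act A' (e₂ R) diag_comm_e₂ ∘ₗ k₂ ∘ₗ q ∘ₗ proj₂ M
  have hH : ∀ x, H x = act A' (e₁ R) diag_comm_e₁ (k₁ (proj₁ M x)) +
    act A' (e₂₁ R) diag_comm_e₂₁ (k₁ (ψ (proj₂ M x))) +
    act A' (e₂ R) diag_comm_e₂ (k₂ (q (proj₂ M x))) := fun _ => rfl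
  have hFH : ∀ x, F (H x) = G x := fun x => by
    rw [hH, map_add, map_add, hF, hF, hF, hk₁, hk₁, hk₂, ← hG, ← hG, ← hG, act_e₁_coe, act_e₂_coe,
      ← coe_structureMap, hψ, add_assoc, ← map_add, ← Submodule.coe_add, sub_add_cancel,
      ← map_add, proj₁_add_proj₂]
  refine ⟨ofCommAct (N := A') H ?_ ?_ ?_, LinearMap.ext hFH⟩
  · intro x
    simp only [hH, map_add, proj₁_act_e₁, proj₂_act_e₁, map_zero, add_zero, act_e₁_act_e₁,
      act_e₁_act_e₂₁, act_e₁_act_e₂]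
  · intro x
    simp only [hH, map_add, proj₁_act_e₂, proj₂_act_e₂, map_zero, zero_add, act_e₂_act_e₁,
      act_e₂_act_e₂₁, act_e₂_act_e₂]
  · intro x
    simp only [hH, map_add, proj₁_act_e₂₁, ← structureMap_proj₁, hψφ, hqφ, map_zero, zero_add,
      add_zero, act_e₂₁_act_e₁, act_e₂₁_act_e₂₁, act_e₂₁_act_e₂]

end Projective

/-! ### Syzygies over a hereditary base. -/

section Hereditary

variable (hR : IsLeftHereditary R)
include hR

/-- Over a left hereditary ring, a syzygy of a `T(R)`-module with injective structure map is
projective. -/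
theorem projective_of_exact {L Q K : ModuleCat.{u} (T2Ext R)} [Module.Projective (T2Ext R) Q]
    {f : L →ₗ[T2Ext R] Q} {g : Q →ₗ[T2Ext R] K} (hf : Function.Injective f)
    (h : Function.Exact f g) (hK : Function.Injective (structureMap K)) :
    Module.Projective (T2Ext R) L := by
  have := projective_comp₁ Q
  have := projective_coker Q
  have := hR.projective_of_injective (map₁ f) (map₁_injective hf)
  have := hR.projective_of_injective (mapCoker f) (mapCoker_injective hf h hK)
  exact projective_of_structureMap_injective L
    (structureMap_injective_of_injective hf (structureMap_injective_of_projective Q))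

/-- Over a left hereditary ring, if an `R`-module `X`, viewed as a `T(R)`-module concentrated in
the first component, has a projective first syzygy, then `X` is projective. -/
theorem projective_of_projective_syzygy {X : ModuleCat.{u} R} {K P : ModuleCat.{u} (T2Ext R)}
    [Module.Projective (T2Ext R) K] [Module.Projective (T2Ext R) P]
    {f : K →ₗ[T2Ext R] P} {g : P →ₗ[T2Ext R] (ModuleCat.restrictScalars (entry₁ R)).obj X}
    (hf : Function.Injective f) (h : Function.Exact f g) (hg : Function.Surjective g) :
    Module.Projective R X := by
  have hgs : ∀ (t : T2Ext R) (x : P), (g (t • x) : X) = entry₁ R t • (g x : X) :=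
    fun t x => map_smul g t x
  -- The target of `g` has zero second component, so `K₂ = P₂`.
  have hbij : Function.Bijective (map₂ f) := by
    refine ⟨map₂_injective hf, fun y => (exact_map₂ h y).1 (Subtype.ext ?_)⟩
    refine (congrArg (resMap g) (act_e₂_coe y).symm).trans ?_
    exact (hgs (e₂ R) (show P from y.1)).trans (by rw [entry₁_e₂, zero_smul]; rfl)
  let e := LinearEquiv.ofBijective (map₂ f) hbij
  -- As `φ^P` is injective, this map has kernel exactly `K₁ = ker π`, so it embeds `X ≅ P₁/K₁` in
  -- `Coker φ^K`.
  let ψ : comp₁ P →ₗ[R] comp₂ K ⧸ LinearMap.range (structureMap K) :=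
    (LinearMap.range (structureMap K)).mkQ ∘ₗ e.symm.toLinearMap ∘ₗ structureMap P
  let π : comp₁ P →ₗ[R] X :=
    { toFun := fun x => g (show P from x.1)
      map_add' := fun x y => map_add g (show P from x.1) (show P from y.1)
      map_smul' := fun r x =>
        (hgs (diag R r) (show P from x.1)).trans (by rw [entry₁_diag]; rfl) }
  have hπ : Function.Surjective π := fun x => by
    obtain ⟨y, hy⟩ := hg x
    exact ⟨proj₁ P y, (hgs (e₁ R) y).trans (by rw [entry₁_e₁, one_smul]; exact hy)⟩
  have hker : LinearMap.ker ψ = LinearMap.ker π := by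
    ext x
    have hx : π x = 0 ↔ map₁ g x = 0 := ⟨fun hx => Subtype.ext hx, congrArg Subtype.val⟩
    rw [LinearMap.mem_ker, LinearMap.mem_ker, hx, exact_map₁ h x]
    refine (Submodule.Quotient.mk_eq_zero _).trans (exists_congr fun z => ?_)
    rw [LinearMap.comp_apply, LinearEquiv.coe_coe, LinearEquiv.eq_symm_apply]
    change map₂ f _ = _ ↔ _
    rw [← structureMap_map₁]
    exact (structureMap_injective_of_projective P).eq_iff
  have := projective_coker K
  have := hR.projective_of_injective _ (LinearMap.range ψ).injective_subtype
  exact Module.Projective.of_equiv (ψ.quotKerEquivRange.symm ≪≫ₗ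
    Submodule.quotEquivOfEq _ _ hker ≪≫ₗ π.quotKerEquivOfSurjective hπ)

end Hereditary

/-! ### Projective dimensions over the triangular ring. -/

section Syzygy

/-- First syzygies of `T(R)`-modules have injective structure map. -/
theorem structureMap_injective_of_isSyzygy {M K : ModuleCat.{u} (T2Ext R)}
    (h : IsSyzygy 1 K M) : Function.Injective (structureMap K) := by
  obtain ⟨L, P, f, g, w, -, hP, hS⟩ := h
  exact structureMap_injective_of_injective hS.moduleCat_injective_f
    (structureMap_injective_of_projective P)

theorem projectiveDimension_le_two (hR : IsLeftHereditary R) (M : ModuleCat.{u} (T2Ext R)) :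
    projectiveDimension M ≤ 2 := by
  have hS := M.shortExact_projectiveShortComplex
  have h₂ : Projective M.projectiveShortComplex.X₂ := inferInstance
  -- `HasProjectiveDimensionLT` is strict, so the index `1` compares bound 3 for `M` with bound 2
  -- for its syzygy.
  have := (projectiveDimension_le_iff M 2).2
    ((hS.hasProjectiveDimensionLT_X₃_iff 1 h₂).2 ((projectiveDimension_le_iff _ 1).1 ?_))
  · exact this
  generalize hK : M.projectiveShortComplex.X₁ = K
  have hφ : Function.Injective (structureMap K) := by
    subst hK
    exact structureMap_injective_of_injective hS.moduleCat_injective_f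
      (structureMap_injective_of_projective _)
  have hS' := K.shortExact_projectiveShortComplex
  have h₂' : Projective K.projectiveShortComplex.X₂ := inferInstance
  rw [Nat.cast_one]
  exact (hS'.projectiveDimension_le_one_iff h₂').2
    (projective_of_exact hR hS'.moduleCat_injective_f
      ((ShortComplex.ShortExact.moduleCat_exact_iff_function_exact _).1 hS'.exact) hφ)

/-- A module that is not projective, placed in the first component, has projective
dimension greater than one over `T(R)`. -/
theorem not_projectiveDimension_le_one (hR : IsLeftHereditary R) {X : ModuleCat.{u} R}
    (hX : ¬ Module.Projective R X) :
    ¬ projectiveDimension ((ModuleCat.restrictScalars (entry₁ R)).obj X) ≤ 1 := by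
  set M := (ModuleCat.restrictScalars (entry₁ R)).obj X with hM
  have hS := M.shortExact_projectiveShortComplex
  have h₂ : Projective M.projectiveShortComplex.X₂ := inferInstance
  intro h
  have := (hS.projectiveDimension_le_one_iff h₂).1 h
  exact hX (projective_of_projective_syzygy hR hS.moduleCat_injective_f
    ((ShortComplex.ShortExact.moduleCat_exact_iff_function_exact _).1 hS.exact)
    hS.moduleCat_surjective_g)

end Syzygy

end T2Ext

/-! ### Conclusion. -/

theorem exists_isSyzygy_one {S : Type u} [Ring S] (M : ModuleCat.{u} S) :
    ∃ K, IsSyzygy 1 K M :=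
  ⟨_, M, _, _, _, M.projectiveShortComplex.zero, ⟨Iso.refl M⟩,
    (inferInstance : Projective M.projectiveShortComplex.X₂),
    M.shortExact_projectiveShortComplex⟩

theorem WithBot.ENat.eq_natCast_add_one {d : WithBot ℕ∞} {n : ℕ} (h : d ≤ (n + 1 : ℕ))
    (h' : ¬ d ≤ n) : d = (n + 1 : ℕ) := by
  refine le_antisymm h ?_
  rw [not_le] at h'
  contrapose! h'
  push_cast at h'
  exact (ENat.WithBot.lt_add_one_iff).1 h'

theorem mainTheorem12 (R : Type u) [Ring R] (hR : IsLeftHereditary R)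
    (hss : ¬ IsSemisimpleRing R) :
    leftGlobalDimension R = 1 ∧
    leftGlobalDimension (T2Ext R) = leftGlobalDimension R + 1 ∧
    leftGlobalDimension (T2Ext R) = 2 ∧
    (∃ M : ModuleCat.{u} (T2Ext R), CategoryTheory.projectiveDimension M = 2) ∧
    (∀ M : ModuleCat.{u} (T2Ext R), CategoryTheory.projectiveDimension M = 2 →
      CategoryTheory.projectiveDimension (T2Ext.fst M) ≤ 1 ∧
      CategoryTheory.projectiveDimension (T2Ext.coker M) ≤ 1 ∧
      (∃ K : ModuleCat.{u} (T2Ext R), IsSyzygy 1 K M) ∧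
      (∀ K : ModuleCat.{u} (T2Ext R), IsSyzygy 1 K M →
        Function.Injective (T2Ext.structureMap K))) ∧
    ¬ ASCharacterisation R 1 := by
  obtain ⟨I, hI⟩ := exists_not_projective_of_not_isSemisimpleRing hss
  let X := ModuleCat.of R (R ⧸ I)
  let M₀ := (ModuleCat.restrictScalars (T2Ext.entry₁ R)).obj X
  have hX : ¬ projectiveDimension X ≤ 0 := fun h => hI
    ((IsProjective.iff_projective (R ⧸ I)).2
      ((projective_iff_hasProjectiveDimensionLE_zero X).2 ((projectiveDimension_le_iff X 0).1 h)))
  have hX₁ : projectiveDimension X = 1 :=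
    WithBot.ENat.eq_natCast_add_one (n := 0) (hR.projectiveDimension_le_one X) hX
  have hM₀ : ¬ projectiveDimension M₀ ≤ 1 := T2Ext.not_projectiveDimension_le_one hR hI
  have hM₀₂ : projectiveDimension M₀ = 2 :=
    WithBot.ENat.eq_natCast_add_one (n := 1) (T2Ext.projectiveDimension_le_two hR M₀) hM₀
  have hlR : leftGlobalDimension R = 1 :=
    le_antisymm (iSup_le hR.projectiveDimension_le_one)
      (hX₁.ge.trans (le_iSup (fun N : ModuleCat.{u} R => projectiveDimension N) X))
  have hlT : leftGlobalDimension (T2Ext R) = 2 :=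
    le_antisymm (iSup_le (T2Ext.projectiveDimension_le_two hR))
      (hM₀₂.ge.trans (le_iSup (fun N : ModuleCat.{u} (T2Ext R) => projectiveDimension N) M₀))
  refine ⟨hlR, by rw [hlR, hlT]; norm_num, hlT, ⟨M₀, hM₀₂⟩, fun M _ =>
    ⟨hR.projectiveDimension_le_one _, hR.projectiveDimension_le_one _, exists_isSyzygy_one M,
      fun K => T2Ext.structureMap_injective_of_isSyzygy⟩, fun h => ?_⟩
  -- All three conditions hold for `M₀`, yet its projective dimension is 2.
  obtain ⟨K, hK⟩ := exists_isSyzygy_one M₀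
  exact hM₀ ((h M₀ K hK).2 ⟨hR.projectiveDimension_le_one _, hR.projectiveDimension_le_one _,
    T2Ext.structureMap_injective_of_isSyzygy hK⟩)
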